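/- Let $A=(A_1,\dots,A_N)$ be a vector of non-negative real random variables on a probability space $(\Omega,\mathcal F,P)$ such that \[ P\Big\{\sum_{i=1}^N \mathbf 1\{A_i>0\}\in\{0,1\}\Big\}<1,\qquad \mathbb E\Big[\sum_{i=1}^N \mathbf 1\{A_i>0\}\Big]>1,\qquad P\{A_i\in\{0,1\}\ \text{for all } i=1,\dots,N\}<1 . \] Let $F_0$ be the distribution function, and $\phi_0$ the characteristic function, of a probability measure on $\mathbb R$. Let $\phi(t,\xi)$, $t\ge 0$, $\xi\in\mathbb R$, be the solution of \[ \partial_t\phi(t,\xi)+\phi(t,\xi)=\mathbb E\Big[\prod_{i=1}^N\phi(t,A_i\xi)\Big]\quad(t>0,\ \xi\in\mathbb R),\qquad \phi(0,\xi)=\phi_0(\xi), \] that is, a function such that $\phi(t,\cdot)$ is the characteristic function of a probability measure for every $t\ge0$, $t\mapsto\phi(t,\xi)$ is differentiable for $t>0$ and continuous at $t=0$ for every $\xi$, and the equation and the initial condition hold. For $s>0$ define $\mathcal S(s)=\mathbb E\big[\sum_{j=1}^N A_j^s\big]-1\in[-1,\infty]$ and $\mu(s)=\mathcal S(s)/s$.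 Let $\gamma\in(0,2]$ and assume that $F_0$ satisfies the following condition: - if $\gamma=1$: either $\int_{\mathbb R}|v|\,dF_0(v)<\infty$, or $F_0$ is symmetric and there is $c_0^+\in(0,\infty)$ with $\lim_{x\to+\infty}x(1-F_0(x))=\lim_{x\to-\infty}|x|F_0(x)=c_0^+$; - if $\gamma=2$: $0<\int_{\mathbb R}v^2\,dF_0(v)<\infty$ and $\int_{\mathbb R}v\,dF_0(v)=0$; - if $\gamma\in(0,1)\cup(1,2)$: $\lim_{x\to+\infty}x^\gamma(1-F_0(x))=c_0^+<\infty$ and $\lim_{x\to-\infty}|x|^\gamma F_0(x)=c_0^-<\infty$ with $c_0^++c_0^->0$, and, in addition, $\int_{\mathbb R}v\,dF_0(v)=0$ if $\gamma>1$. If $\mu(\delta)<\mu(\gamma)<\infty$ for some $0<\delta<\gamma$, then \[ \lim_{t\to+\infty}\phi\big(t,e^{-\mu(\gamma)t}\xi\big)=1\qquad\text{for every }\xi\in\mathbb R . \] -/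

import Mathlib

open MeasureTheory ProbabilityTheory Filter Topology Set

open scoped ENNReal

namespace KacLike

/-- The smoothing transformation
`Q̂(φ₁, …, φ_N)(ξ) = E[φ₁(A₁ ξ) ⋯ φ_N(A_N ξ)]`. -/
noncomputable def smoothing {Ω : Type*} [MeasurableSpace Ω] (P : Measure Ω) {N : ℕ}
    (A : Fin N → Ω → ℝ) (φ : Fin N → ℝ → ℂ) (ξ : ℝ) : ℂ :=
  ∫ ω, ∏ i, φ i (A i ω * ξ) ∂P

/-- `φ(t, ξ)`, `t ≥ 0`, is a solution of the Kac-like equation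
`∂ₜ φ(t, ξ) + φ(t, ξ) = Q̂(φ(t, ·), …, φ(t, ·))(ξ)` for `t > 0`, `ξ ∈ ℝ`,
with initial condition `φ(0, ·) = φ₀`, the characteristic function of `ρ₀`.
Every `φ(t, ·)` is the characteristic function of a probability measure `ρ_t`,
and `t ↦ φ(t, ξ)` is continuous up to `t = 0`. -/
structure IsSolution {Ω : Type*} [MeasurableSpace Ω] (P : Measure Ω) {N : ℕ}
    (A : Fin N → Ω → ℝ) (ρ₀ : Measure ℝ) (φ : ℝ → ℝ → ℂ) : Prop where
  isCharFun : ∀ t, 0 ≤ t → ∃ ρ : Measure ℝ, IsProbabilityMeasure ρ ∧ φ t = charFun ρ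
  initial : ∀ ξ, φ 0 ξ = charFun ρ₀ ξ
  continuous_zero : ∀ ξ, ContinuousWithinAt (fun t => φ t ξ) (Ici 0) 0
  differentiable : ∀ t, 0 < t → ∀ ξ, DifferentiableAt ℝ (fun s => φ s ξ) t
  equation : ∀ t, 0 < t → ∀ ξ,
    deriv (fun s => φ s ξ) t + φ t ξ = smoothing P A (fun _ => φ t) ξ

/-- The number of indices `i` with `A_i > 0`. -/
noncomputable def numPos {Ω : Type*} {N : ℕ} (A : Fin N → Ω → ℝ) (ω : Ω) : ℕ :=
  (Finset.univ.filter fun i => 0 < A i ω).card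

/-- The non-degeneracy assumptions on the weights. -/
structure WeightHyp {Ω : Type*} [MeasurableSpace Ω] (P : Measure Ω) {N : ℕ}
    (A : Fin N → Ω → ℝ) : Prop where
  count_lt : P {ω | numPos A ω ∈ ({0, 1} : Set ℕ)} < 1
  mean_count : 1 < ∫ ω, (numPos A ω : ℝ) ∂P
  not_zero_one : P {ω | ∀ i, A i ω = 0 ∨ A i ω = 1} < 1

/-- The power `a ^ s` with the convention `0 ^ 0 = 0`. -/
noncomputable def powZ (a s : ℝ) : ℝ := if a = 0 then 0 else a ^ s

/-- `𝒮(s) = E[∑ⱼ Aⱼ ^ s] - 1`, with values in `[-1, ∞]`. -/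
noncomputable def convexS {Ω : Type*} [MeasurableSpace Ω] (P : Measure Ω) {N : ℕ}
    (A : Fin N → Ω → ℝ) (s : ℝ) : EReal :=
  ((∫⁻ ω, ∑ j, ENNReal.ofReal (powZ (A j ω) s) ∂P : ℝ≥0∞) : EReal) - 1

/-- The spectral function `μ(s) = 𝒮(s) / s`, for `s > 0`, with values in `(-∞, ∞]`. -/
noncomputable def spectral {Ω : Type*} [MeasurableSpace Ω] (P : Measure Ω) {N : ℕ}
    (A : Fin N → Ω → ℝ) (s : ℝ) : EReal :=
  convexS P A s / (s : EReal)

/-- `lim_{x → +∞} x ^ γ (1 - F₀(x)) = cp` and `lim_{x → -∞} |x| ^ γ F₀(x) = cm`, where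
`F₀` is the distribution function of `ρ₀`. -/
def TailCondition (γ : ℝ) (ρ₀ : Measure ℝ) (cp cm : ℝ) : Prop :=
  Tendsto (fun x : ℝ => x ^ γ * (1 - cdf ρ₀ x)) atTop (𝓝 cp) ∧
    Tendsto (fun x : ℝ => |x| ^ γ * cdf ρ₀ x) atBot (𝓝 cm)

/-- The hypothesis for `γ = 1`: finite first absolute moment, or symmetry together with the
tail condition of exponent `1` with a positive constant. -/
def HypOne (ρ₀ : Measure ℝ) : Prop :=
  Integrable (fun v : ℝ => v) ρ₀ ∨
    (ρ₀.map (fun v : ℝ => -v) = ρ₀ ∧ ∃ c : ℝ, 0 < c ∧ TailCondition 1 ρ₀ c c)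

/-- The hypothesis for `γ = 2`: centered, with finite and positive variance. -/
def HypTwo (ρ₀ : Measure ℝ) : Prop :=
  Integrable (fun v : ℝ => v ^ 2) ρ₀ ∧ 0 < ∫ v, v ^ 2 ∂ρ₀ ∧ ∫ v, v ∂ρ₀ = 0

/-- The hypothesis for `γ ∈ (0, 1) ∪ (1, 2)`. -/
def HypStable (γ : ℝ) (ρ₀ : Measure ℝ) : Prop :=
  (∃ cp cm : ℝ, 0 < cp + cm ∧ TailCondition γ ρ₀ cp cm) ∧
    (1 < γ → Integrable (fun v : ℝ => v) ρ₀ ∧ ∫ v, v ∂ρ₀ = 0)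

/-- The hypothesis on the initial law, for `γ ∈ (0, 2]`. -/
def HypGamma (γ : ℝ) (ρ₀ : Measure ℝ) : Prop :=
  (γ = 1 → HypOne ρ₀) ∧ (γ = 2 → HypTwo ρ₀) ∧ (γ ∈ Ioo 0 1 ∪ Ioo 1 2 → HypStable γ ρ₀)

end KacLike

namespace KacLike

/-! The functions `C * |ξ| ^ δ * exp (𝒮(δ) t)` solve the linearised equation `∂ₜ u + u = E[∑ᵢ u(Aᵢ
ξ)]` exactly, because `|ξ| ^ δ` is homogeneous. Since `‖1 - ∏ zᵢ‖ ≤ ∑ ‖1 - zᵢ‖` on the unit disc,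
they dominate `‖1 - φ‖` at all times if they do at time `0` (`IsSolution.norm_one_sub_le`). At the
point `exp (-μ(γ) t) ξ` the bound becomes `C * |ξ| ^ δ * exp (δ (μ(δ) - μ(γ)) t)`, which decays. The
Hölder bound at time `0` (`HypGamma.exists_norm_one_sub_charFun_le`) comes from a finite absolute
moment of order `δ < γ`, together with centring when `δ ≥ 1`. -/

lemma norm_one_sub_prod_le {ι : Type*} (s : Finset ι) {z : ι → ℂ} (hz : ∀ i, ‖z i‖ ≤ 1) :
    ‖1 - ∏ i ∈ s, z i‖ ≤ ∑ i ∈ s, ‖1 - z i‖ := by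
  classical
  induction s using Finset.induction_on with
  | empty => simp
  | insert a s ha ih =>
    rw [Finset.prod_insert ha, Finset.sum_insert ha]
    have h : 1 - z a * ∏ i ∈ s, z i = (1 - z a) + z a * (1 - ∏ i ∈ s, z i) := by ring
    rw [h]
    refine (norm_add_le _ _).trans (add_le_add le_rfl ?_)
    rw [norm_mul]
    exact (mul_le_of_le_one_left (norm_nonneg _) (hz a)).trans ih

/-- Comparison principle on the half line for the sum of a function and its derivative. -/
lemma norm_le_of_norm_deriv_add_self_le {u : ℝ → ℂ} {B B' : ℝ → ℝ}
    (hu0 : ContinuousWithinAt u (Ici 0) 0) (hu : ∀ t, 0 < t → DifferentiableAt ℝ u t)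
    (hB : ∀ t, HasDerivAt B (B' t) t)
    (bound : ∀ t, 0 < t → ‖deriv u t + u t‖ ≤ B' t + B t) (h0 : ‖u 0‖ ≤ B 0)
    {t : ℝ} (ht : 0 ≤ t) : ‖u t‖ ≤ B t := by
  rcases ht.eq_or_lt with rfl | ht
  · exact h0
  -- The integrating factor `exp s` turns `u' + u` into a pure derivative.
  set w : ℝ → ℂ := fun s => Real.exp s • u s with hw
  set W : ℝ → ℝ := fun s => Real.exp s * B s with hW
  have hw' : ∀ s, 0 < s → HasDerivAt w (Real.exp s • (deriv u s + u s)) s := by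
    intro s hs
    have := (Real.hasDerivAt_exp s).smul (hu s hs).hasDerivAt
    rwa [smul_add]
  have hW' : ∀ s, HasDerivAt W (Real.exp s * (B' s + B s)) s := by
    intro s
    have := (Real.hasDerivAt_exp s).mul (hB s)
    convert! this using 1
    ring
  -- The comparison starts at `ε > 0`, since `u` is only continuous at `0`; then `ε → 0`.
  have key : ∀ ε, 0 < ε → ε ≤ t → ‖w t‖ ≤ W t + (‖w ε‖ - W ε) := by
    intro ε hε hεt
    refine image_norm_le_of_norm_deriv_right_le_deriv_boundary (f := w)
      (f' := fun s => Real.exp s • (deriv u s + u s)) (a := ε) (b := t)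
      (B := fun s => W s + (‖w ε‖ - W ε)) (B' := fun s => Real.exp s * (B' s + B s))
      ?_ ?_ ?_ ?_ ?_ (right_mem_Icc.2 hεt)
    · exact fun s hs => (hw' s (hε.trans_le hs.1)).continuousAt.continuousWithinAt
    · exact fun s hs => (hw' s (hε.trans_le hs.1)).hasDerivWithinAt
    · simp
    · exact fun s => (hW' s).add_const _
    · intro s hs
      rw [norm_smul, Real.norm_of_nonneg (Real.exp_pos s).le]
      exact mul_le_mul_of_nonneg_left (bound s (hε.trans_le hs.1)) (Real.exp_pos s).le
  have hcw : Tendsto w (𝓝[>] 0) (𝓝 (w 0)) :=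
    ((Real.continuous_exp.continuousWithinAt (s := Ici 0)).smul hu0).tendsto.mono_left
      (nhdsWithin_mono _ Ioi_subset_Ici_self)
  have hcW : Tendsto W (𝓝[>] 0) (𝓝 (W 0)) :=
    (hW' 0).continuousAt.tendsto.mono_left nhdsWithin_le_nhds
  have hlim : ‖w t‖ ≤ W t + (‖w 0‖ - W 0) := by
    refine ge_of_tendsto (tendsto_const_nhds.add (hcw.norm.sub hcW)) ?_
    filter_upwards [Ioc_mem_nhdsGT ht] with ε hε using key ε hε.1 hε.2
  have hw0 : ‖w 0‖ ≤ W 0 := by simpa [hw, hW] using h0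
  have : Real.exp t * ‖u t‖ ≤ Real.exp t * B t := by
    have h1 : ‖w t‖ = Real.exp t * ‖u t‖ := by
      rw [hw, norm_smul, Real.norm_of_nonneg (Real.exp_pos t).le]
    rw [← h1]
    change _ ≤ W t
    linarith
  exact le_of_mul_le_mul_left this (Real.exp_pos t)

/-! ### Propagation in time of Hölder bounds at the origin -/

section Evolution

variable {Ω : Type*} [MeasurableSpace Ω] {P : Measure Ω} [IsProbabilityMeasure P] {N : ℕ}
  {A : Fin N → Ω → ℝ} {ρ₀ : Measure ℝ} {φ : ℝ → ℝ → ℂ}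

lemma norm_one_sub_smoothing_le (hA_meas : ∀ i, Measurable (A i)) {ψ : ℝ → ℂ}
    (hψ : Continuous ψ) (hψ1 : ∀ x, ‖ψ x‖ ≤ 1) (ξ : ℝ) {g : Ω → ℝ} (hg : Integrable g P)
    (h : ∀ᵐ ω ∂P, ∑ i, ‖1 - ψ (A i ω * ξ)‖ ≤ g ω) :
    ‖1 - smoothing P A (fun _ => ψ) ξ‖ ≤ ∫ ω, g ω ∂P := by
  have hmeas : Measurable fun ω => ∏ i, ψ (A i ω * ξ) :=
    Finset.measurable_fun_prod _ fun i _ =>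
      hψ.measurable.comp ((hA_meas i).mul_const ξ)
  have hint : Integrable (fun ω => ∏ i, ψ (A i ω * ξ)) P := by
    refine Integrable.of_bound hmeas.aestronglyMeasurable 1 (ae_of_all _ fun ω => ?_)
    rw [norm_prod]
    exact Finset.prod_le_one (fun _ _ => norm_nonneg _) fun _ _ => hψ1 _
  have heq : 1 - smoothing P A (fun _ => ψ) ξ = ∫ ω, (1 - ∏ i, ψ (A i ω * ξ)) ∂P := by
    rw [integral_sub (integrable_const _) hint]
    simp [smoothing]
  rw [heq]
  refine norm_integral_le_of_norm_le hg ?_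
  filter_upwards [h] with ω hω
  exact (norm_one_sub_prod_le _ fun _ => hψ1 _).trans hω

/-- Picard-type iteration from the trivial bound `2`. Each pass through the equation multiplies the
error by at most `N` and integrates it in time, hence the factor `(N t) ^ n / n!`, which vanishes as
`n → ∞`. -/
lemma IsSolution.norm_one_sub_le_add (hφ : IsSolution P A ρ₀ φ)
    (hA_meas : ∀ i, Measurable (A i)) (hA_nonneg : ∀ᵐ ω ∂P, ∀ i, 0 ≤ A i ω)
    {δ C : ℝ} (hC : 0 ≤ C) (hint : Integrable (fun ω => ∑ i, A i ω ^ δ) P)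
    (h0 : ∀ ξ, ‖1 - charFun ρ₀ ξ‖ ≤ C * |ξ| ^ δ) (n : ℕ) :
    ∀ t, 0 ≤ t → ∀ ξ, ‖1 - φ t ξ‖ ≤
      C * |ξ| ^ δ * Real.exp (((∫ ω, ∑ i, A i ω ^ δ ∂P) - 1) * t)
        + 2 * ((N * t) ^ n / n.factorial) := by
  set M := ∫ ω, ∑ i, A i ω ^ δ ∂P with hM
  induction n with
  | zero =>
    intro t ht ξ
    obtain ⟨ρ, hρ, hφt⟩ := hφ.isCharFun t ht
    have h2 : ‖1 - φ t ξ‖ ≤ 2 := by rw [hφt]; exact norm_one_sub_charFun_le_two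
    have : 0 ≤ C * |ξ| ^ δ * Real.exp ((M - 1) * t) := by positivity
    simpa using h2.trans (le_add_of_nonneg_left this)
  | succ n ih =>
    intro t ht ξ
    refine norm_le_of_norm_deriv_add_self_le (u := fun s => 1 - φ s ξ)
      (B := fun s => C * |ξ| ^ δ * Real.exp ((M - 1) * s)
        + 2 * ((N * s) ^ (n + 1) / (n + 1).factorial))
      (B' := fun s => C * |ξ| ^ δ * (Real.exp ((M - 1) * s) * (M - 1))
        + 2 * (N * ((N * s) ^ n / n.factorial)))
      (continuousWithinAt_const.sub (hφ.continuous_zero ξ))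
      (fun s hs => (differentiableAt_const _).sub (hφ.differentiable s hs ξ)) ?_ ?_ ?_ ht
    · intro s
      have h1 : HasDerivAt (fun s : ℝ => (M - 1) * s) (M - 1) s := by
        simpa using (hasDerivAt_id s).const_mul (M - 1)
      have h2 : HasDerivAt (fun s : ℝ => N * s) N s := by
        simpa using (hasDerivAt_id s).const_mul (N : ℝ)
      refine (h1.exp.const_mul _).add (HasDerivAt.const_mul 2 ?_)
      refine ((h2.pow (n + 1)).div_const _).congr_deriv ?_
      rw [Nat.factorial_succ]
      have : (n.factorial : ℝ) ≠ 0 := by positivity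
      push_cast
      field_simp
    · intro s hs
      obtain ⟨ρ, hρ, hφs⟩ := hφ.isCharFun s hs.le
      have heq : deriv (fun r => 1 - φ r ξ) s + (1 - φ s ξ)
          = 1 - smoothing P A (fun _ => φ s) ξ := by
        rw [deriv_const_sub, ← hφ.equation s hs ξ]
        ring
      rw [heq]
      set E := Real.exp ((M - 1) * s)
      set R := 2 * ((N * s) ^ n / (n.factorial : ℝ)) with hR
      have hg : Integrable (fun ω => C * |ξ| ^ δ * E * (∑ i, A i ω ^ δ) + N * R) P :=
        (hint.const_mul _).add (integrable_const _)
      have hle := norm_one_sub_smoothing_le (P := P) (ψ := φ s) hA_meas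
        (by rw [hφs]; exact continuous_charFun)
        (fun x => by rw [hφs]; exact norm_charFun_le_one x) ξ hg (by
          filter_upwards [hA_nonneg] with ω hω
          calc ∑ i, ‖1 - φ s (A i ω * ξ)‖
              ≤ ∑ i, (C * |ξ| ^ δ * E * A i ω ^ δ + R) := by
                refine Finset.sum_le_sum fun i _ => (ih s hs.le _).trans_eq ?_
                rw [abs_mul, abs_of_nonneg (hω i), Real.mul_rpow (hω i) (abs_nonneg _)]
                ring
            _ = _ := by
                rw [Finset.sum_add_distrib, ← Finset.mul_sum]
                simp)
      refine hle.trans ?_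
      rw [integral_add (hint.const_mul _) (integrable_const _), integral_const_mul]
      -- The main terms of both sides agree; this nonnegative term is the whole slack.
      have : 0 ≤ 2 * ((N * s) ^ (n + 1) / ((n + 1).factorial : ℝ)) := by positivity
      simp only [integral_const, probReal_univ, one_smul]
      rw [← hM, hR]
      nlinarith
    · have := h0 ξ
      simpa [hφ.initial ξ] using this

/-- A Hölder bound at the origin for the initial datum propagates, with exponential rate
`E[∑ᵢ Aᵢ ^ δ] - 1`. -/
lemma IsSolution.norm_one_sub_le (hφ : IsSolution P A ρ₀ φ)
    (hA_meas : ∀ i, Measurable (A i)) (hA_nonneg : ∀ᵐ ω ∂P, ∀ i, 0 ≤ A i ω)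
    {δ C : ℝ} (hC : 0 ≤ C) (hint : Integrable (fun ω => ∑ i, A i ω ^ δ) P)
    (h0 : ∀ ξ, ‖1 - charFun ρ₀ ξ‖ ≤ C * |ξ| ^ δ) {t : ℝ} (ht : 0 ≤ t) (ξ : ℝ) :
    ‖1 - φ t ξ‖ ≤ C * |ξ| ^ δ * Real.exp (((∫ ω, ∑ i, A i ω ^ δ ∂P) - 1) * t) := by
  have hlim := ((FloorSemiring.tendsto_pow_div_factorial_atTop ((N : ℝ) * t)).const_mul
    2).const_add (C * |ξ| ^ δ * Real.exp (((∫ ω, ∑ i, A i ω ^ δ ∂P) - 1) * t))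
  rw [mul_zero, add_zero] at hlim
  exact ge_of_tendsto' hlim fun n =>
    hφ.norm_one_sub_le_add hA_meas hA_nonneg hC hint h0 n t ht ξ

end Evolution

/-! ### Moments and Hölder bounds for the initial law -/

section Initial

lemma HypGamma.integral_eq_zero {ρ₀ : Measure ℝ} {γ : ℝ} (h : HypGamma γ ρ₀) (hγ2 : γ ≤ 2) (hγ1 : 1 < γ) :
    ∫ v, v ∂ρ₀ = 0 := by
  rcases hγ2.eq_or_lt with h2 | h2
  · exact (h.2.1 h2).2.2
  · exact ((h.2.2 (Or.inr ⟨hγ1, h2⟩)).2 hγ1).2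

variable {ρ₀ : Measure ℝ} [IsProbabilityMeasure ρ₀] {γ δ : ℝ}

lemma TailCondition.exists_measure_lt_abs_le {cp cm : ℝ} (h : TailCondition γ ρ₀ cp cm) :
    ∃ K x₀ : ℝ, 0 ≤ K ∧ 0 < x₀ ∧
      ∀ x, x₀ < x → ρ₀ {v | x < |v|} ≤ ENNReal.ofReal (K * x ^ (-γ)) := by
  obtain ⟨hp, hm⟩ := h
  have hm' := hm.comp tendsto_neg_atTop_atBot
  have hsum := (hp.add hm').eventually (gt_mem_nhds (lt_add_one (cp + cm)))
  obtain ⟨x₁, hx₁⟩ := eventually_atTop.1 hsum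
  -- The rescaled two-sided tail tends to `cp + cm`, so it is eventually below `cp + cm + 1`.
  refine ⟨max (cp + cm + 1) 0, max x₁ 1, le_max_right _ _, by positivity, fun x hx => ?_⟩
  have hx1 : x₁ ≤ x := (le_max_left _ _).trans hx.le
  have hx0 : 0 < x := one_pos.trans_le ((le_max_right _ _).trans hx.le)
  have hb := hx₁ x hx1
  simp only [Function.comp, abs_neg, abs_of_pos hx0] at hb
  have hsub : {v : ℝ | x < |v|} ⊆ (Iic x)ᶜ ∪ Iic (-x) := by
    intro v hv
    rcases lt_abs.1 (show x < |v| from hv) with h | h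
    · left; simpa using h
    · right; simp only [mem_Iic]; linarith
  have hreal : ρ₀.real {v | x < |v|} ≤ (1 - cdf ρ₀ x) + cdf ρ₀ (-x) := by
    refine (measureReal_mono hsub).trans ((measureReal_union_le _ _).trans_eq ?_)
    rw [probReal_compl_eq_one_sub measurableSet_Iic, cdf_eq_real, cdf_eq_real]
  rw [← ofReal_measureReal]
  refine ENNReal.ofReal_le_ofReal (hreal.trans ?_)
  have hxγ : 0 < x ^ γ := Real.rpow_pos_of_pos hx0 γ
  rw [Real.rpow_neg hx0.le, ← div_eq_mul_inv, le_div_iff₀ hxγ]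
  refine le_trans ?_ (le_max_left _ _)
  linarith

lemma TailCondition.integrable_abs_rpow {cp cm : ℝ} (h : TailCondition γ ρ₀ cp cm)
    (hδ : 0 < δ) (hδγ : δ < γ) : Integrable (fun v : ℝ => |v| ^ δ) ρ₀ := by
  obtain ⟨K, x₀, hK, hx₀, hle⟩ := h.exists_measure_lt_abs_le
  have hmeas : Measurable fun v : ℝ => |v| ^ δ := by fun_prop
  refine ⟨hmeas.aestronglyMeasurable, ?_⟩
  rw [hasFiniteIntegral_iff_ofReal (ae_of_all _ fun v => by positivity),
    lintegral_rpow_eq_lintegral_meas_lt_mul ρ₀ (ae_of_all _ fun v => abs_nonneg v)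
      (by fun_prop) hδ]
  refine ENNReal.mul_lt_top ENNReal.ofReal_lt_top ?_
  -- Layer-cake integral, split at `x₀`: below it the probability is at most `1` and `x ^ (δ - 1)`
  -- is integrable because `δ > 0`; above it the integrand is at most `K * x ^ (δ - 1 - γ)`,
  -- integrable because `δ < γ`.
  rw [← Ioc_union_Ioi_eq_Ioi hx₀.le]
  refine (lintegral_union_le _ _ _).trans_lt (ENNReal.add_lt_top.2 ⟨?_, ?_⟩)
  · have hi : IntegrableOn (fun x : ℝ => x ^ (δ - 1)) (Ioc 0 x₀) :=
      (intervalIntegrable_iff_integrableOn_Ioc_of_le hx₀.le).1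
        (intervalIntegral.intervalIntegrable_rpow' (by linarith))
    refine lt_of_le_of_lt (lintegral_mono fun x => ?_) hi.lintegral_lt_top
    exact mul_le_of_le_one_left zero_le prob_le_one
  · have hi : IntegrableOn (fun x : ℝ => K * x ^ (-γ + (δ - 1))) (Ioi x₀) :=
      (integrableOn_Ioi_rpow_of_lt (by linarith) hx₀).const_mul K
    refine lt_of_le_of_lt (setLIntegral_mono' measurableSet_Ioi fun x hx => ?_)
      hi.lintegral_lt_top
    have hx0 : 0 < x := hx₀.trans hx
    refine (mul_le_mul_left (hle x hx) _).trans_eq ?_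
    rw [← ENNReal.ofReal_mul (by positivity), mul_assoc, ← Real.rpow_add hx0]

lemma abs_rpow_le_one_add_abs_rpow (hδ : 0 ≤ δ) (hδγ : δ ≤ γ) (v : ℝ) :
    |v| ^ δ ≤ 1 + |v| ^ γ := by
  rcases le_total |v| 1 with h | h
  · exact (Real.rpow_le_one (abs_nonneg v) h hδ).trans (le_add_of_nonneg_right (by positivity))
  · exact (Real.rpow_le_rpow_of_exponent_le h hδγ).trans (le_add_of_nonneg_left zero_le_one)

lemma integrable_abs_rpow_of_le (hδ : 0 ≤ δ) (hδγ : δ ≤ γ)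
    (h : Integrable (fun v : ℝ => |v| ^ γ) ρ₀) : Integrable (fun v : ℝ => |v| ^ δ) ρ₀ := by
  have hmeas : Measurable fun v : ℝ => |v| ^ δ := by fun_prop
  refine ((integrable_const (1 : ℝ)).add h).mono' hmeas.aestronglyMeasurable
    (ae_of_all _ fun v => ?_)
  rw [Real.norm_of_nonneg (by positivity)]
  exact abs_rpow_le_one_add_abs_rpow hδ hδγ v

lemma HypGamma.integrable_abs_rpow (h : HypGamma γ ρ₀) (hγ : γ ∈ Ioc (0 : ℝ) 2)
    (hδ : 0 < δ) (hδγ : δ < γ) : Integrable (fun v : ℝ => |v| ^ δ) ρ₀ := by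
  by_cases h1 : γ = 1
  · subst h1
    rcases h.1 rfl with hi | ⟨-, c, -, hc⟩
    · exact integrable_abs_rpow_of_le hδ.le hδγ.le (by simpa using hi.abs)
    · exact hc.integrable_abs_rpow hδ hδγ
  by_cases h2 : γ = 2
  · subst h2
    exact integrable_abs_rpow_of_le hδ.le hδγ.le (by simpa using (h.2.1 rfl).1)
  have hmem : γ ∈ Ioo (0 : ℝ) 1 ∪ Ioo 1 2 := by
    rcases lt_or_gt_of_ne h1 with h' | h'
    · exact Or.inl ⟨hγ.1, h'⟩
    · exact Or.inr ⟨h', lt_of_le_of_ne hγ.2 h2⟩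
  obtain ⟨⟨cp, cm, -, hc⟩, -⟩ := h.2.2 hmem
  exact hc.integrable_abs_rpow hδ hδγ

/-- Interpolates between the linear bound near `0` and the bound `2` elsewhere. -/
lemma norm_one_sub_exp_mul_I_le (hδ : 0 ≤ δ) (hδ1 : δ ≤ 1) (x : ℝ) :
    ‖1 - Complex.exp (x * Complex.I)‖ ≤ 2 * |x| ^ δ := by
  rcases le_total |x| 1 with h | h
  · have h1 : ‖1 - Complex.exp (x * Complex.I)‖ ≤ |x| := by
      rw [norm_sub_rev, mul_comm]
      exact Real.norm_exp_I_mul_ofReal_sub_one_le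
    have h2 : |x| ≤ |x| ^ δ := by
      rcases (abs_nonneg x).eq_or_lt with h0 | h0
      · rw [← h0]; positivity
      · simpa using Real.rpow_le_rpow_of_exponent_ge h0 h hδ1
    have : 0 ≤ |x| ^ δ := by positivity
    linarith
  · have h1 : ‖1 - Complex.exp (x * Complex.I)‖ ≤ 2 := by
      refine (norm_sub_le _ _).trans ?_
      rw [Complex.norm_exp_ofReal_mul_I]
      norm_num
    have := Real.one_le_rpow h hδ
    linarith

/-- Interpolates between the quadratic Taylor remainder near `0` and linear growth elsewhere. -/
lemma norm_one_sub_exp_mul_I_add_le (hδ1 : 1 ≤ δ) (hδ2 : δ ≤ 2) (x : ℝ) :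
    ‖1 - Complex.exp (x * Complex.I) + x * Complex.I‖ ≤ 3 * |x| ^ δ := by
  have hn : ‖(x * Complex.I : ℂ)‖ = |x| := by simp
  rcases le_total |x| 1 with h | h
  · have h1 : ‖1 - Complex.exp (x * Complex.I) + x * Complex.I‖ ≤ |x| ^ 2 := by
      have := Complex.norm_exp_sub_one_sub_id_le (x := x * Complex.I) (hn.trans_le h)
      rw [hn] at this
      rw [← norm_neg]
      convert! this using 2
      ring
    have h2 : |x| ^ 2 ≤ |x| ^ δ := by
      rcases (abs_nonneg x).eq_or_lt with h0 | h0
      · rw [← h0]; simpa using Real.rpow_nonneg le_rfl δ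
      · simpa using Real.rpow_le_rpow_of_exponent_ge h0 h hδ2
    have : 0 ≤ |x| ^ δ := by positivity
    linarith
  · have h1 : ‖1 - Complex.exp (x * Complex.I) + x * Complex.I‖ ≤ 1 + 1 + |x| := by
      refine (norm_add_le _ _).trans (add_le_add ((norm_sub_le _ _).trans ?_) hn.le)
      rw [Complex.norm_exp_ofReal_mul_I]
      simp
    have h2 : |x| ≤ |x| ^ δ := by
      simpa using Real.rpow_le_rpow_of_exponent_le h hδ1
    linarith

lemma norm_one_sub_charFun_le_of_le_one (hδ : 0 ≤ δ) (hδ1 : δ ≤ 1)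
    (hint : Integrable (fun v : ℝ => |v| ^ δ) ρ₀) (ξ : ℝ) :
    ‖1 - charFun ρ₀ ξ‖ ≤ 2 * (∫ v, |v| ^ δ ∂ρ₀) * |ξ| ^ δ := by
  have hexp : Integrable (fun v : ℝ => Complex.exp (ξ * v * Complex.I)) ρ₀ :=
    Integrable.of_bound (by fun_prop) 1 (ae_of_all _ fun v => by
      rw [← Complex.ofReal_mul, Complex.norm_exp_ofReal_mul_I])
  have heq : 1 - charFun ρ₀ ξ = ∫ v : ℝ, (1 - Complex.exp (ξ * v * Complex.I)) ∂ρ₀ := by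
    rw [integral_sub (integrable_const _) hexp, charFun_apply_real]
    simp
  rw [heq]
  refine (norm_integral_le_of_norm_le (hint.const_mul (2 * |ξ| ^ δ))
    (ae_of_all _ fun v => ?_)).trans_eq (by rw [integral_const_mul]; ring)
  have := norm_one_sub_exp_mul_I_le hδ hδ1 (ξ * v)
  rw [abs_mul, Real.mul_rpow (abs_nonneg _) (abs_nonneg _)] at this
  push_cast at this
  linarith

/-- Centring allows the first-order Taylor term to be added under the integral at no cost. -/
lemma norm_one_sub_charFun_le_of_one_le (hδ1 : 1 ≤ δ) (hδ2 : δ ≤ 2)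
    (hint : Integrable (fun v : ℝ => |v| ^ δ) ρ₀) (hmean : ∫ v, v ∂ρ₀ = 0) (ξ : ℝ) :
    ‖1 - charFun ρ₀ ξ‖ ≤ 3 * (∫ v, |v| ^ δ ∂ρ₀) * |ξ| ^ δ := by
  have hexp : Integrable (fun v : ℝ => Complex.exp (ξ * v * Complex.I)) ρ₀ :=
    Integrable.of_bound (by fun_prop) 1 (ae_of_all _ fun v => by
      rw [← Complex.ofReal_mul, Complex.norm_exp_ofReal_mul_I])
  have hid : Integrable (fun v : ℝ => v) ρ₀ := by
    have h := integrable_abs_rpow_of_le zero_le_one hδ1 hint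
    simp only [Real.rpow_one] at h
    exact (integrable_norm_iff measurable_id.aestronglyMeasurable).1 h
  have hlin : Integrable (fun v : ℝ => (ξ * v * Complex.I : ℂ)) ρ₀ :=
    (hid.ofReal.const_mul (ξ : ℂ)).mul_const _
  have hzero : ∫ v : ℝ, (ξ * v * Complex.I : ℂ) ∂ρ₀ = 0 := by
    have h : ∫ v : ℝ, (v : ℂ) ∂ρ₀ = 0 := by
      rw [integral_complex_ofReal, hmean, Complex.ofReal_zero]
    rw [integral_mul_const, integral_const_mul, h]
    simp
  have heq : 1 - charFun ρ₀ ξ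
      = ∫ v : ℝ, (1 - Complex.exp (ξ * v * Complex.I) + ξ * v * Complex.I) ∂ρ₀ := by
    have hsub : Integrable (fun v : ℝ => 1 - Complex.exp (ξ * v * Complex.I)) ρ₀ :=
      (integrable_const _).sub hexp
    rw [integral_add hsub hlin, integral_sub (integrable_const _) hexp, charFun_apply_real, hzero]
    simp
  rw [heq]
  refine (norm_integral_le_of_norm_le (hint.const_mul (3 * |ξ| ^ δ))
    (ae_of_all _ fun v => ?_)).trans_eq (by rw [integral_const_mul]; ring)
  have := norm_one_sub_exp_mul_I_add_le hδ1 hδ2 (ξ * v)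
  rw [abs_mul, Real.mul_rpow (abs_nonneg _) (abs_nonneg _)] at this
  push_cast at this
  linarith

lemma HypGamma.exists_norm_one_sub_charFun_le (h : HypGamma γ ρ₀) (hγ : γ ∈ Ioc (0 : ℝ) 2)
    (hδ : 0 < δ) (hδγ : δ < γ) :
    ∃ C : ℝ, 0 ≤ C ∧ ∀ ξ, ‖1 - charFun ρ₀ ξ‖ ≤ C * |ξ| ^ δ := by
  have hint := h.integrable_abs_rpow hγ hδ hδγ
  have hnn : 0 ≤ ∫ v, |v| ^ δ ∂ρ₀ := integral_nonneg fun v => by positivity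
  -- Centring is needed only when `1 ≤ δ`, and then `γ > 1`, where it is part of the hypothesis.
  rcases le_total δ 1 with h1 | h1
  · exact ⟨_, by positivity, norm_one_sub_charFun_le_of_le_one hδ.le h1 hint⟩
  · exact ⟨_, by positivity, norm_one_sub_charFun_le_of_one_le h1 (hδγ.le.trans hγ.2) hint
      (h.integral_eq_zero hγ.2 (h1.trans_lt hδγ))⟩

end Initial

/-! ### From the extended-real spectral function to real integrals -/

section Spectral

variable {Ω : Type*} [MeasurableSpace Ω] {P : Measure Ω} {N : ℕ} {A : Fin N → Ω → ℝ} {δ : ℝ}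

lemma powZ_of_pos (hδ : 0 < δ) (a : ℝ) : powZ a δ = a ^ δ := by
  unfold powZ
  split_ifs with h
  · rw [h, Real.zero_rpow hδ.ne']
  · rfl

lemma integrable_sum_rpow_of_spectral_lt_top (hA_meas : ∀ i, Measurable (A i))
    (hA_nonneg : ∀ᵐ ω ∂P, ∀ i, 0 ≤ A i ω) (hδ : 0 < δ) (h : spectral P A δ < ⊤) :
    Integrable (fun ω => ∑ i, A i ω ^ δ) P ∧
      spectral P A δ = (((∫ ω, ∑ i, A i ω ^ δ ∂P) - 1) / δ : ℝ) := by
  have hmeas : Measurable fun ω => ∑ i, A i ω ^ δ := by fun_prop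
  have hnn : 0 ≤ᵐ[P] fun ω => ∑ i, A i ω ^ δ := by
    filter_upwards [hA_nonneg] with ω hω
    exact Finset.sum_nonneg fun i _ => Real.rpow_nonneg (hω i) δ
  have heq : ∫⁻ ω, ∑ j, ENNReal.ofReal (powZ (A j ω) δ) ∂P
      = ∫⁻ ω, ENNReal.ofReal (∑ i, A i ω ^ δ) ∂P := by
    refine lintegral_congr_ae ?_
    filter_upwards [hA_nonneg] with ω hω
    rw [ENNReal.ofReal_sum_of_nonneg fun i _ => Real.rpow_nonneg (hω i) δ]
    simp only [powZ_of_pos hδ]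
  -- An infinite moment would make the quotient by the positive real `δ` equal to `⊤`.
  have hfin : ∫⁻ ω, ENNReal.ofReal (∑ i, A i ω ^ δ) ∂P ≠ ⊤ := by
    intro htop
    rw [spectral, convexS, heq, htop, EReal.coe_ennreal_top,
      show (⊤ : EReal) - 1 = ⊤ from EReal.top_sub_coe 1,
      EReal.top_div_of_pos_ne_top (by exact_mod_cast hδ) (EReal.coe_ne_top δ)] at h
    exact lt_irrefl _ h
  have hint : Integrable (fun ω => ∑ i, A i ω ^ δ) P :=
    ⟨hmeas.aestronglyMeasurable, by
      rw [hasFiniteIntegral_iff_ofReal hnn]; exact hfin.lt_top⟩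
  refine ⟨hint, ?_⟩
  rw [spectral, convexS, heq, ← ofReal_integral_eq_lintegral_ofReal hint hnn,
    EReal.coe_ennreal_ofReal, max_eq_left (integral_nonneg_of_ae hnn)]
  norm_cast

end Spectral

end KacLike

theorem theorem3 {Ω : Type*} [MeasurableSpace Ω] (P : Measure Ω) [IsProbabilityMeasure P]
    {N : ℕ} (A : Fin N → Ω → ℝ) (hA_meas : ∀ i, Measurable (A i))
    (hA_nonneg : ∀ᵐ ω ∂P, ∀ i, 0 ≤ A i ω) (hA : KacLike.WeightHyp P A)
    (ρ₀ : Measure ℝ) [IsProbabilityMeasure ρ₀]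
    (γ : ℝ) (hγ : γ ∈ Ioc (0 : ℝ) 2) (hρ₀ : KacLike.HypGamma γ ρ₀)
    (hμ : ∃ δ : ℝ, 0 < δ ∧ δ < γ ∧ KacLike.spectral P A δ < KacLike.spectral P A γ)
    (hμγ : KacLike.spectral P A γ < ⊤)
    (φ : ℝ → ℝ → ℂ) (hφ : KacLike.IsSolution P A ρ₀ φ) (ξ : ℝ) :
    Tendsto (fun t : ℝ => φ t (Real.exp (-(t * (KacLike.spectral P A γ).toReal)) * ξ))
      atTop (𝓝 1) := by
  obtain ⟨δ, hδ, hδγ, hlt⟩ := hμ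
  obtain ⟨hint, hspec⟩ := KacLike.integrable_sum_rpow_of_spectral_lt_top hA_meas hA_nonneg hδ
    (hlt.trans hμγ)
  obtain ⟨C, hC, hC0⟩ := hρ₀.exists_norm_one_sub_charFun_le hγ hδ hδγ
  set M := ∫ ω, ∑ i, A i ω ^ δ ∂P
  set m := (KacLike.spectral P A γ).toReal with hm
  -- The left side is `δ (μ(δ) - μ(γ))`. Here `μ(γ)` is not `⊥`, being above `μ(δ)`, so `toReal`
  -- loses nothing.
  have hrate : M - 1 - δ * m < 0 := by
    rw [hspec, ← EReal.coe_toReal hμγ.ne (bot_le.trans_lt hlt).ne', ← hm, EReal.coe_lt_coe_iff,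
      div_lt_iff₀ hδ] at hlt
    linarith
  have hbound : ∀ t : ℝ, 0 ≤ t → ‖1 - φ t (Real.exp (-(t * m)) * ξ)‖ ≤
      C * |ξ| ^ δ * Real.exp ((M - 1 - δ * m) * t) := by
    intro t ht
    refine (hφ.norm_one_sub_le hA_meas hA_nonneg hC hint hC0 ht _).trans_eq ?_
    rw [abs_mul, abs_of_pos (Real.exp_pos _), Real.mul_rpow (Real.exp_pos _).le (abs_nonneg _),
      ← Real.exp_mul, show (M - 1 - δ * m) * t = -(t * m) * δ + (M - 1) * t by ring, Real.exp_add]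
    ring
  have hlim : Tendsto (fun t : ℝ => C * |ξ| ^ δ * Real.exp ((M - 1 - δ * m) * t))
      atTop (𝓝 0) := by
    simpa using (Real.tendsto_exp_atBot.comp
      (tendsto_id.const_mul_atTop_of_neg hrate)).const_mul (C * |ξ| ^ δ)
  rw [tendsto_iff_norm_sub_tendsto_zero]
  refine squeeze_zero' (.of_forall fun t => norm_nonneg _) ?_ hlim
  filter_upwards [eventually_ge_atTop 0] with t ht
  rw [norm_sub_rev]
  exact hbound t ht
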